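/- Let $\tau>0$, let $\lambda_0,\lambda\in L^\infty(\mathbb{R})$ be real-valued, let $H:=L^2(\mathbb{R})$ be the space of real-valued square integrable functions, and let $u_0\in C([-\tau,0];H)$. Consider the linear delayed KdV--Burgers problem $$\begin{cases}u_t(x,t)+u_{xxx}(x,t)-u_{xx}(x,t)+\lambda_0(x)u(x,t)+\lambda(x)u(x,t-\tau)=0&\text{in }\mathbb{R}\times(0,\infty),\\ u(x,s)=u_0(x,s)&\text{in }\mathbb{R}\times[-\tau,0].\end{cases}\tag{1.2}$$ Let $A_{\lambda_0}f:=-f_{xxx}+f_{xx}-\lambda_0f$ with domain $H^3(\mathbb{R})$. By a (mild) solution of (1.2) we mean a function $u\in C([-\tau,\infty);H)$ with $u(s)=u_0(s)$ for all $s\in[-\tau,0]$ such that $A_{\lambda_0}$ generates a strongly continuous semigroup $(S(t))_{t\ge0}$ in $H$ and $$u(t)=S(t)u_0(0)-\int_0^tS(t-s)\,\lambda\,u(s-\tau)\,ds\qquad\text{for all }t\ge0.$$ Then (1.2) has a unique solution $u\in C([-\tau,\infty);H)$; in particular, $A_{\lambda_0}$ generates a strongly continuous semigroup in $H$. -/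

import Mathlib

open MeasureTheory Set Filter Topology
open scoped ENNReal ContDiff

noncomputable section

namespace DelayKdVB

/-- The real Hilbert space `L²(ℝ)` of real-valued functions. -/
abbrev L2 : Type := Lp ℝ 2 (volume : Measure ℝ)

/-- The space `L^∞(ℝ)` of real-valued functions. For `a : LInf` and `f : L2`, the product
`a • f : L2` is the class of the pointwise product `x ↦ a x * f x`. -/
abbrev LInf : Type := Lp ℝ ∞ (volume : Measure ℝ)

/-- `g ∈ L²(ℝ)` is the weak derivative of `f ∈ L²(ℝ)`: `∫ f φ' = -∫ g φ` for all test functions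
`φ` (smooth with compact support). -/
def HasWeakDeriv (f g : L2) : Prop :=
  ∀ φ : ℝ → ℝ, ContDiff ℝ ∞ φ → HasCompactSupport φ →
    ∫ x, f x * deriv φ x = -∫ x, g x * φ x

/-- The graph of the unbounded operator `A_{λ₀} f = -f_{xxx} + f_{xx} - λ₀ f` on `L²(ℝ)` with
domain `H³(ℝ)`: `f` has weak derivatives `f₁ = f_x`, `f₂ = f_{xx}`, `f₃ = f_{xxx}` in `L²(ℝ)`, and
`A_{λ₀} f = g`. -/
def GraphA (lam0 : LInf) (f g : L2) : Prop :=
  ∃ f₁ f₂ f₃ : L2, HasWeakDeriv f f₁ ∧ HasWeakDeriv f₁ f₂ ∧ HasWeakDeriv f₂ f₃ ∧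
    g = -f₃ + f₂ - (lam0 • f : L2)

/-- `(S t)_{t ≥ 0}` is a strongly continuous semigroup of bounded linear operators on `L²(ℝ)`
(the values at `t < 0` are irrelevant). -/
structure IsC0Semigroup (S : ℝ → L2 →L[ℝ] L2) : Prop where
  map_zero : S 0 = ContinuousLinearMap.id ℝ L2
  map_add : ∀ s t : ℝ, 0 ≤ s → 0 ≤ t → S (s + t) = (S s).comp (S t)
  continuousOn : ∀ f : L2, ContinuousOn (fun t => S t f) (Ici 0)

/-- The operator with graph `G` is the infinitesimal generator of `S`: a vector `f` lies in its
domain with image `g` if and only if `(S h f - f) / h → g` in `L²(ℝ)` as `h → 0⁺`. -/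
def IsGenerator (S : ℝ → L2 →L[ℝ] L2) (G : L2 → L2 → Prop) : Prop :=
  ∀ f g : L2, G f g ↔ Tendsto (fun h : ℝ => h⁻¹ • (S h f - f)) (𝓝[>] 0) (𝓝 g)

/-- `u ∈ C([-τ, ∞); L²(ℝ))` is a (mild) solution of the delayed problem
`u_t + u_{xxx} - u_{xx} + λ₀ u + λ u(· - τ) = 0` for `t > 0`, `u = u₀` on `[-τ, 0]`: with `S` the
strongly continuous semigroup generated by `A_{λ₀}`, Duhamel's formula holds for all `t ≥ 0`.
(A semigroup is determined by its generator, so `S` is unique on `[0, ∞)`. The integrand is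
continuous on `[0, t]`.) -/
structure IsSolution (τ : ℝ) (lam0 lam : LInf) (u₀ u : ℝ → L2) : Prop where
  continuousOn : ContinuousOn u (Ici (-τ))
  history : ∀ s ∈ Icc (-τ) 0, u s = u₀ s
  duhamel : ∃ S : ℝ → L2 →L[ℝ] L2, IsC0Semigroup S ∧ IsGenerator S (GraphA lam0) ∧
    ∀ t : ℝ, 0 ≤ t → u t = S t (u₀ 0) - ∫ s in (0 : ℝ)..t, S (t - s) (lam • u (s - τ) : L2)

end DelayKdVB

end

/-! The delay term at time t involves u only at time t - τ. Once A_{λ₀} is known to generate a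
semigroup, Duhamel's formula therefore determines u on each interval of length τ from values already
known, which gives existence (`exists_delay_duhamel`) and uniqueness (`eqOn_of_delay_duhamel`).

The main work is the generation. On complex L², the Fourier transform turns -∂³ + ∂² into
multiplication by a symbol with real part -(2πξ)² ≤ 0, so multiplication by exp(t · symbol) is a
contraction semigroup with the right generator (`generates_mulSemigroup`,
`complexGraph_iff_symbol`). The coefficients are real, so this semigroup commutes with conjugation
and restricts to real-valued functions. The term λ₀ f is bounded and enters through a Volterra
equation (`exists_perturbed_semigroup`).

A solution may bring its own semigroup, so uniqueness of u also rests on the fact that the generator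
determines the semigroup (`eq_of_generates`). That fact also yields the commutation with
conjugation. -/

namespace DelayKdVB

/-! ### Strongly continuous semigroups and uniqueness from the generator -/

section Semigroup

variable {X : Type*} [NormedAddCommGroup X] [NormedSpace ℝ X]

/-- `(S t)_{t ≥ 0}` is a strongly continuous semigroup of bounded linear operators. -/
structure StronglyContinuousSemigroup (S : ℝ → X →L[ℝ] X) : Prop where
  map_zero : S 0 = ContinuousLinearMap.id ℝ X
  map_add : ∀ s t : ℝ, 0 ≤ s → 0 ≤ t → S (s + t) = (S s).comp (S t)
  continuousOn : ∀ f : X, ContinuousOn (fun t => S t f) (Ici 0)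

/-- The infinitesimal generator of `S` has graph `G`. -/
def Generates (S : ℝ → X →L[ℝ] X) (G : X → X → Prop) : Prop :=
  ∀ f g : X, G f g ↔ Tendsto (fun h : ℝ => h⁻¹ • (S h f - f)) (𝓝[>] 0) (𝓝 g)

/-- The mean over `[0, h]` of a jointly continuous family tends to its value at the origin. -/
theorem tendsto_inv_smul_integral [CompleteSpace X] {F : ℝ → ℝ → X} (hF : Continuous F.uncurry) :
    Tendsto (fun h : ℝ => h⁻¹ • ∫ s in (0 : ℝ)..h, F h s) (𝓝[>] 0) (𝓝 (F 0 0)) := by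
  -- The substitution s = h r turns the mean into an integral over the fixed interval [0, 1],
  -- continuous in h.
  have hc : Continuous fun h : ℝ => ∫ r in (0 : ℝ)..1, F h (h * r) := by
    apply intervalIntegral.continuous_parametric_intervalIntegral_of_continuous'
    exact hF.comp (by fun_prop : Continuous fun p : ℝ × ℝ => (p.1, p.1 * p.2))
  have h0 := (hc.tendsto 0).mono_left (nhdsWithin_le_nhds (s := Ioi 0))
  simp only [zero_mul, intervalIntegral.integral_const, sub_zero, one_smul] at h0
  refine h0.congr' ?_
  filter_upwards [self_mem_nhdsWithin] with h hh
  have hne : h ≠ 0 := ne_of_gt hh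
  have := intervalIntegral.smul_integral_comp_mul_left (a := 0) (b := 1) (fun s => F h s) h
  rw [mul_zero, mul_one] at this
  rw [← this, smul_smul, inv_mul_cancel₀ hne, one_smul]

namespace StronglyContinuousSemigroup

variable {S T : ℝ → X →L[ℝ] X}

theorem map_add_apply (hS : StronglyContinuousSemigroup S) {s t : ℝ} (hs : 0 ≤ s) (ht : 0 ≤ t)
    (f : X) : S (s + t) f = S s (S t f) := by
  rw [hS.map_add s t hs ht]; rfl

theorem map_zero_apply (hS : StronglyContinuousSemigroup S) (f : X) : S 0 f = f := by
  rw [hS.map_zero]; rfl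

theorem map_comm (hS : StronglyContinuousSemigroup S) {s t : ℝ} (hs : 0 ≤ s) (ht : 0 ≤ t)
    (f : X) : S s (S t f) = S t (S s f) := by
  rw [← hS.map_add_apply hs ht, ← hS.map_add_apply ht hs, add_comm]

/-- Truncating time by `max t 0` gives a function continuous on all of ℝ, so that integrals and
compositions need no side conditions on the sign of t. -/
theorem continuous_apply (hS : StronglyContinuousSemigroup S) (f : X) :
    Continuous fun t : ℝ => S (max t 0) f :=
  (hS.continuousOn f).comp_continuous (by fun_prop) fun _ => mem_Ici.2 (le_max_right _ _)

variable [CompleteSpace X]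

theorem exists_norm_le (hS : StronglyContinuousSemigroup S) (b : ℝ) :
    ∃ C : ℝ, ∀ t : ℝ, t ≤ b → ‖S (max t 0)‖ ≤ C := by
  obtain ⟨C, hC⟩ := banach_steinhaus (g := fun t : Icc (0 : ℝ) (max b 0) => S t) (by
    intro f
    obtain ⟨C, hC⟩ := (isCompact_Icc (a := (0 : ℝ)) (b := max b 0)).exists_bound_of_continuousOn
      ((hS.continuousOn f).mono Icc_subset_Ici_self)
    exact ⟨C, fun t => hC t t.2⟩)
  exact ⟨C, fun t ht => hC ⟨max t 0, le_max_right _ _, max_le_max_right _ ht⟩⟩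

/-- Operator norms are bounded on compact time intervals by Banach–Steinhaus; together with strong
continuity this gives joint continuity. -/
theorem continuous_uncurry (hS : StronglyContinuousSemigroup S) :
    Continuous fun p : ℝ × X => S (max p.1 0) p.2 := by
  rw [continuous_iff_continuousAt]
  rintro ⟨t₀, f₀⟩
  obtain ⟨C, hC⟩ := hS.exists_norm_le (t₀ + 1)
  have hlim : Tendsto (fun p : ℝ × X => C * ‖p.2 - f₀‖ + ‖S (max p.1 0) f₀ - S (max t₀ 0) f₀‖)
      (𝓝 (t₀, f₀)) (𝓝 0) := by
    have hc : Continuous fun p : ℝ × X =>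
        C * ‖p.2 - f₀‖ + ‖S (max p.1 0) f₀ - S (max t₀ 0) f₀‖ := by
      have h1 : Continuous fun p : ℝ × X => S (max p.1 0) f₀ :=
        (hS.continuous_apply f₀).comp continuous_fst
      exact ((continuous_snd.sub continuous_const).norm.const_mul C).add
        (h1.sub continuous_const).norm
    simpa using hc.tendsto (t₀, f₀)
  rw [ContinuousAt, tendsto_iff_norm_sub_tendsto_zero]
  refine squeeze_zero' (Eventually.of_forall fun _ => norm_nonneg _) ?_ hlim
  have hev : ∀ᶠ p : ℝ × X in 𝓝 (t₀, f₀), p.1 < t₀ + 1 :=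
    (continuous_fst.tendsto (t₀, f₀)).eventually (gt_mem_nhds (by simp))
  filter_upwards [hev] with p hp
  calc ‖S (max p.1 0) p.2 - S (max t₀ 0) f₀‖
      = ‖S (max p.1 0) (p.2 - f₀) + (S (max p.1 0) f₀ - S (max t₀ 0) f₀)‖ := by
        rw [map_sub]; congr 1; abel
    _ ≤ _ := (norm_add_le _ _).trans (by
        gcongr
        exact (S (max p.1 0)).le_of_opNorm_le (hC _ hp.le) _)

theorem continuous_comp {Z : Type*} [TopologicalSpace Z] (hS : StronglyContinuousSemigroup S)
    {a : Z → ℝ} {f : Z → X} (ha : Continuous a) (hf : Continuous f) :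
    Continuous fun z => S (max (a z) 0) (f z) :=
  hS.continuous_uncurry.comp (ha.prodMk hf)

theorem continuous_duhamel (hS : StronglyContinuousSemigroup S) {f : ℝ → X} (hf : Continuous f) :
    Continuous fun t : ℝ => ∫ s in (0 : ℝ)..t, S (max (t - s) 0) (f s) := by
  refine intervalIntegral.continuous_parametric_intervalIntegral_of_continuous
    (f := fun t s => S (max (t - s) 0) (f s)) ?_ continuous_id
  exact hS.continuous_comp (by fun_prop) (hf.comp continuous_snd)

/-- The domain of the generator is dense. -/
theorem dense_domain (hS : StronglyContinuousSemigroup S) {G : X → X → Prop}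
    (hG : Generates S G) : Dense {f | ∃ g, G f g} := by
  intro f
  have hcont : Continuous fun s : ℝ => S (max s 0) f := hS.continuous_apply f
  have hlim := tendsto_inv_smul_integral (F := fun _ s => S (max s 0) f)
    (hcont.comp continuous_snd)
  simp only [max_self, hS.map_zero_apply] at hlim
  refine mem_closure_of_tendsto hlim ?_
  filter_upwards [self_mem_nhdsWithin] with h hh
  have hh : 0 < h := hh
  -- The approximants are the means of s ↦ S s f over [0, h]. Applying S k shifts the window of
  -- integration, so the difference quotient reduces to short integrals at the two ends, with limits
  -- S h f and f.
  refine ⟨h⁻¹ • (S h f - f), (hG _ _).2 ?_⟩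
  have h1 := tendsto_inv_smul_integral (F := fun _ s => S (max (h + s) 0) f)
    (hcont.comp (by fun_prop : Continuous fun p : ℝ × ℝ => h + p.2))
  simp only [add_zero, max_eq_left hh.le] at h1
  refine ((h1.sub hlim).const_smul h⁻¹).congr' ?_
  filter_upwards [self_mem_nhdsWithin] with k hk
  have hk : 0 < k := hk
  have hint : ∀ a b : ℝ, IntervalIntegrable (fun s : ℝ => S (max s 0) f) volume a b :=
    fun a b => hcont.intervalIntegrable a b
  have e1 : S k (∫ s in (0 : ℝ)..h, S (max s 0) f) = ∫ s in k..k + h, S (max s 0) f := by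
    rw [← ContinuousLinearMap.intervalIntegral_comp_comm _ (hint 0 h)]
    have := intervalIntegral.integral_comp_add_left (a := 0) (b := h)
      (fun s => S (max s 0) f) k
    rw [add_zero] at this
    rw [← this]
    refine intervalIntegral.integral_congr fun s hs => ?_
    rw [uIcc_of_le hh.le] at hs
    simp only [max_eq_left hs.1, max_eq_left (add_nonneg hk.le hs.1)]
    exact (hS.map_add_apply hk.le hs.1 f).symm
  have e2 : ∫ s in (0 : ℝ)..k, S (max (h + s) 0) f = ∫ s in h..h + k, S (max s 0) f := by
    have := intervalIntegral.integral_comp_add_left (a := 0) (b := k)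
      (fun s => S (max s 0) f) h
    rwa [add_zero] at this
  have e3 : (∫ s in k..k + h, S (max s 0) f) - ∫ s in (0 : ℝ)..h, S (max s 0) f
      = (∫ s in h..h + k, S (max s 0) f) - ∫ s in (0 : ℝ)..k, S (max s 0) f := by
    have i1 := intervalIntegral.integral_add_adjacent_intervals (hint 0 k) (hint k (k + h))
    have i2 := intervalIntegral.integral_add_adjacent_intervals (hint 0 h) (hint h (k + h))
    rw [add_comm h k, eq_sub_of_add_eq' i1, eq_sub_of_add_eq' i2]
    abel
  rw [map_smul, e1, e2, ← smul_sub, ← smul_sub, e3.symm, smul_comm]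

omit [CompleteSpace X] in
/-- The domain of the generator is invariant under the semigroup. -/
theorem generator_apply (hS : StronglyContinuousSemigroup S) {G : X → X → Prop}
    (hG : Generates S G) {f g : X} (hfg : G f g) {t : ℝ} (ht : 0 ≤ t) : G (S t f) (S t g) := by
  rw [hG] at hfg ⊢
  refine (((S t).continuous.tendsto g).comp hfg).congr' ?_
  filter_upwards [self_mem_nhdsWithin] with h hh
  simp only [Function.comp_apply, map_smul, map_sub]
  rw [hS.map_comm ht (le_of_lt hh)]

/-- A strongly continuous semigroup is determined by its generator. -/
theorem eq_of_generates (hS : StronglyContinuousSemigroup S) (hT : StronglyContinuousSemigroup T)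
    {G : X → X → Prop} (hGS : Generates S G) (hGT : Generates T G) {t : ℝ} (ht : 0 ≤ t) :
    S t = T t := by
  have key : ∀ f g : X, G f g → S t f = T t f := by
    intro f g hfg
    -- The curve s ↦ T (t - s) (S s f) joins T t f to S t f; it is constant because its right
    -- derivative vanishes.
    have hcont : ContinuousOn (fun s : ℝ => T (max (t - s) 0) (S (max s 0) f)) (Icc 0 t) :=
      (hT.continuous_comp (by fun_prop) (hS.continuous_apply f)).continuousOn
    have hder : ∀ s ∈ Ico 0 t, HasDerivWithinAt
        (fun s : ℝ => T (max (t - s) 0) (S (max s 0) f)) 0 (Ici s) s := by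
      intro s hs
      have hG' := hS.generator_apply hGS hfg hs.1
      have h1 := (hGS _ _).1 hG'
      have h2 := (hGT _ _).1 hG'
      have h3 := h1.sub h2
      rw [sub_self] at h3
      have hlin : Tendsto (fun h : ℝ => t - s - h) (𝓝[>] 0) (𝓝 (t - s)) := by
        have : Continuous fun h : ℝ => t - s - h := by fun_prop
        simpa using (this.tendsto 0).mono_left (nhdsWithin_le_nhds (s := Ioi 0))
      -- With y = S s f, the slope at step h is T (t - s - h) applied to (S h y - T h y) / h. That
      -- vector tends to 0, both generators giving the same limit at y; since the time varies too,
      -- joint continuity is needed.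
      have h4 := (hT.continuous_uncurry.tendsto (t - s, (0 : X))).comp (hlin.prodMk_nhds h3)
      dsimp only at h4
      rw [_root_.map_zero] at h4
      rw [hasDerivWithinAt_iff_tendsto_slope, Ici_sdiff_left]
      have hsub : Tendsto (fun r : ℝ => r - s) (𝓝[>] s) (𝓝[>] 0) := by
        have : Tendsto (fun r : ℝ => r - s) (𝓝[>] s) (𝓝 0) := by
          have hc : Continuous fun r : ℝ => r - s := by fun_prop
          simpa using (hc.tendsto s).mono_left (nhdsWithin_le_nhds (s := Ioi s))
        refine tendsto_nhdsWithin_iff.2 ⟨this, ?_⟩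
        filter_upwards [self_mem_nhdsWithin] with r hr
        exact sub_pos.2 (mem_Ioi.1 hr)
      refine (h4.comp hsub).congr' ?_
      filter_upwards [Ioo_mem_nhdsGT hs.2] with r hr
      have hr0 : 0 ≤ r := hs.1.trans hr.1.le
      have hrs : 0 ≤ r - s := sub_nonneg.2 hr.1.le
      have htr : 0 ≤ t - r := sub_nonneg.2 hr.2.le
      simp only [Function.comp_apply, slope_def_module, sub_sub_sub_cancel_right,
        max_eq_left hr0, max_eq_left hs.1, max_eq_left htr,
        max_eq_left (sub_nonneg.2 hs.2.le)]
      rw [← smul_sub, sub_sub_sub_cancel_right, map_smul, map_sub,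
        ← hS.map_add_apply hrs hs.1, ← hT.map_add_apply htr hrs]
      simp
    have := constant_of_has_deriv_right_zero hcont hder t (right_mem_Icc.2 ht)
    simpa [ht, hT.map_zero_apply, hS.map_zero_apply] using this
  have hd := hS.dense_domain hGS
  refine ContinuousLinearMap.ext fun f => ?_
  exact congrFun (Continuous.ext_on hd (S t).continuous (T t).continuous
    fun f ⟨g, hg⟩ => key f g hg) f

end StronglyContinuousSemigroup

end Semigroup

/-! ### Restriction and conjugation of semigroups -/

namespace StronglyContinuousSemigroup

variable {X Y : Type*} [NormedAddCommGroup X] [NormedSpace ℝ X]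
  [NormedAddCommGroup Y] [NormedSpace ℝ Y] {S : ℝ → Y →L[ℝ] Y}

/-- Restriction of a semigroup to a complemented invariant subspace, embedded by `J` with left
inverse `P`. -/
theorem restrict (hS : StronglyContinuousSemigroup S) {J : X →L[ℝ] Y} {P : Y →L[ℝ] X}
    (hPJ : ∀ x, P (J x) = x) (hinv : ∀ t, 0 ≤ t → ∀ x, J (P (S t (J x))) = S t (J x)) :
    StronglyContinuousSemigroup fun t => P ∘L S t ∘L J where
  map_zero := by
    ext1 x
    simp [hS.map_zero, hPJ]
  map_add s t hs ht := by
    ext1 x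
    simp [hS.map_add_apply hs ht, hinv t ht]
  continuousOn f := P.continuous.comp_continuousOn (hS.continuousOn (J f))

theorem generates_restrict {J : X →L[ℝ] Y} {P : Y →L[ℝ] X}
    (hPJ : ∀ x, P (J x) = x) (hinv : ∀ t, 0 ≤ t → ∀ x, J (P (S t (J x))) = S t (J x))
    {G : Y → Y → Prop} (hG : Generates S G) :
    Generates (fun t => P ∘L S t ∘L J) fun f g => G (J f) (J g) := by
  intro f g
  refine (hG _ _).trans ?_
  constructor
  · intro h
    have := (P.continuous.tendsto _).comp h
    rw [hPJ] at this
    refine this.congr fun h => ?_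
    simp [hPJ]
  · intro h
    refine ((J.continuous.tendsto _).comp h).congr' ?_
    filter_upwards [self_mem_nhdsWithin] with h hh
    simp [hinv h (le_of_lt hh)]

/-- Transport of a semigroup along a continuous linear equivalence. -/
theorem conj (hS : StronglyContinuousSemigroup S) (e : X ≃L[ℝ] Y) :
    StronglyContinuousSemigroup fun t => (e.symm : Y →L[ℝ] X) ∘L S t ∘L (e : X →L[ℝ] Y) :=
  hS.restrict (by simp) (by simp)

theorem generates_conj {G : Y → Y → Prop} (hG : Generates S G) (e : X ≃L[ℝ] Y) :
    Generates (fun t => (e.symm : Y →L[ℝ] X) ∘L S t ∘L (e : X →L[ℝ] Y))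
      fun f g => G (e f) (e g) :=
  generates_restrict (by simp) (by simp) hG

end StronglyContinuousSemigroup

/-! ### Bounded perturbation through a Volterra equation -/

section Perturbation

variable {X : Type*} [NormedAddCommGroup X] [NormedSpace ℝ X] [CompleteSpace X]
  {S : ℝ → X →L[ℝ] X}

omit [CompleteSpace X] in
/-- The homogeneous Volterra equation has only the trivial solution. -/
theorem eq_zero_of_volterra {C : ℝ} (hS1 : ∀ t, 0 ≤ t → ‖S t‖ ≤ C)
    (B : X →L[ℝ] X) {d : ℝ → X} (hd : Continuous d)
    (heq : ∀ t, 0 ≤ t → d t = -∫ s in (0 : ℝ)..t, S (max (t - s) 0) (B (d s))) :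
    ∀ t, 0 ≤ t → d t = 0 := by
  intro t ht
  -- Grönwall: φ 0 = 0 and φ' = ‖d‖ ≤ C ‖B‖ φ, hence φ = 0.
  set φ : ℝ → ℝ := fun t => ∫ s in (0 : ℝ)..t, ‖d s‖ with hφ
  have hderiv : ∀ x, HasDerivAt φ ‖d x‖ x := fun x =>
    intervalIntegral.integral_hasDerivAt_right (hd.norm.intervalIntegrable _ _)
      (hd.norm.stronglyMeasurableAtFilter _ _) hd.norm.continuousAt
  have hC : 0 ≤ C := (norm_nonneg _).trans (hS1 0 le_rfl)
  have hbound : ∀ x, 0 ≤ x → ‖d x‖ ≤ C * ‖B‖ * φ x := by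
    intro x hx
    rw [heq x hx, norm_neg, hφ]
    simp only
    rw [← intervalIntegral.integral_const_mul]
    refine intervalIntegral.norm_integral_le_of_norm_le hx (Eventually.of_forall fun s _ => ?_)
      ((hd.norm.const_mul _).intervalIntegrable _ _)
    rw [mul_assoc]
    exact ((S (max (x - s) 0)).le_of_opNorm_le (hS1 _ (le_max_right _ _)) _).trans
      (by gcongr; exact B.le_opNorm _)
  have hφ0 : ∀ x, 0 ≤ x → 0 ≤ φ x := fun x hx =>
    intervalIntegral.integral_nonneg hx fun _ _ => norm_nonneg _
  have hz : φ t = 0 := by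
    refine eq_zero_of_abs_deriv_le_mul_abs_self_of_eq_zero_right (a := 0) (b := t)
      (K := C * ‖B‖) (fun x _ => (hderiv x).continuousAt.continuousWithinAt)
      (fun x _ => (hderiv x).hasDerivWithinAt) (by simp [hφ]) (fun x hx => ?_) t
      (right_mem_Icc.2 ht)
    rw [norm_norm, Real.norm_of_nonneg (hφ0 x hx.1)]
    exact hbound x hx.1
  have := hbound t ht
  rw [hz, mul_zero] at this
  exact norm_le_zero_iff.1 this

open BoundedContinuousFunction in
/-- For a contraction semigroup, the Volterra equation `u = S f - S * B u` is solved by a family of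
bounded linear operators. -/
theorem exists_volterra_solution (hS : StronglyContinuousSemigroup S)
    (hS1 : ∀ t, 0 ≤ t → ‖S t‖ ≤ 1) (B : X →L[ℝ] X) :
    ∃ T : ℝ → X →L[ℝ] X, (∀ f, Continuous fun t => T t f) ∧
      ∀ f t, T t f = S (max t 0) f
        - ∫ s in (0 : ℝ)..max t 0, S (max (max t 0 - s) 0) (B (T s f)) := by
  -- The weight exp(-κ t) makes the Volterra operator a contraction on all of [0, ∞) at once: its
  -- norm is at most ‖B‖ ∫ exp(-κ s) ds ≤ ‖B‖ / κ < 1. Adding 1 makes this strict and keeps κ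
  -- positive when B = 0.
  set κ : ℝ := ‖B‖ + 1 with hκ
  have hκ0 : 0 < κ := by positivity
  have hS1' : ∀ (t : ℝ) (x : X), ‖S (max t 0) x‖ ≤ ‖x‖ := fun t x => by
    simpa using (S (max t 0)).le_of_opNorm_le (hS1 _ (le_max_right _ _)) x
  have hJbound : ∀ (f : X) (t : ℝ), ‖Real.exp (-κ * max t 0) • S (max t 0) f‖ ≤ ‖f‖ := by
    intro f t
    rw [norm_smul, Real.norm_eq_abs, Real.abs_exp]
    refine (mul_le_of_le_one_left (norm_nonneg _) ?_).trans (hS1' t f)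
    rw [Real.exp_le_one_iff, neg_mul, neg_nonpos]
    positivity
  let J : X →L[ℝ] (ℝ →ᵇ X) := LinearMap.mkContinuous
    { toFun := fun f => BoundedContinuousFunction.ofNormedAddCommGroup
        (fun t => Real.exp (-κ * max t 0) • S (max t 0) f)
        ((by fun_prop : Continuous fun t : ℝ => Real.exp (-κ * max t 0)).smul
          (hS.continuous_apply f)) ‖f‖ (hJbound f)
      map_add' := fun f g => by ext t; simp
      map_smul' := fun c f => by ext t; simp [smul_comm c] } 1
    (fun f => by
      rw [one_mul]
      exact BoundedContinuousFunction.norm_ofNormedAddCommGroup_le _ (norm_nonneg _) (hJbound f))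
  have hKcont : ∀ v : ℝ →ᵇ X, Continuous fun t : ℝ =>
      ∫ s in (0 : ℝ)..max t 0, Real.exp (-κ * (max t 0 - s)) •
        S (max (max t 0 - s) 0) (B (v s)) := by
    intro v
    refine intervalIntegral.continuous_parametric_intervalIntegral_of_continuous
      (f := fun t s => Real.exp (-κ * (max t 0 - s)) • S (max (max t 0 - s) 0) (B (v s)))
      (Continuous.smul (f := fun p : ℝ × ℝ => Real.exp (-κ * (max p.1 0 - p.2)))
        (by fun_prop) (hS.continuous_comp (by fun_prop) ?_)) (by fun_prop)
    exact B.continuous.comp (v.continuous.comp continuous_snd)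
  have hKint : ∀ (v : ℝ →ᵇ X) (t : ℝ), IntervalIntegrable (fun s =>
      Real.exp (-κ * (max t 0 - s)) • S (max (max t 0 - s) 0) (B (v s))) volume 0 (max t 0) := by
    intro v t
    refine Continuous.intervalIntegrable (Continuous.smul (by fun_prop)
      (hS.continuous_comp (by fun_prop) (B.continuous.comp v.continuous))) _ _
  have hKbound : ∀ (v : ℝ →ᵇ X) (t : ℝ), ‖∫ s in (0 : ℝ)..max t 0,
      Real.exp (-κ * (max t 0 - s)) • S (max (max t 0 - s) 0) (B (v s))‖
        ≤ ‖B‖ / κ * ‖v‖ := by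
    intro v t
    set r := max t 0 with hr
    have hr0 : 0 ≤ r := le_max_right _ _
    have hder : ∀ s : ℝ, HasDerivAt (fun s => κ⁻¹ * Real.exp (-κ * (r - s)))
        (Real.exp (-κ * (r - s))) s := by
      intro s
      have h1 : HasDerivAt (fun s : ℝ => -κ * (r - s)) κ s := by
        simpa using ((hasDerivAt_id s).const_sub r).const_mul (-κ)
      refine (h1.exp.const_mul κ⁻¹).congr_deriv ?_
      field_simp
    have hint : ∫ s in (0 : ℝ)..r, Real.exp (-κ * (r - s)) ≤ κ⁻¹ := by
      rw [intervalIntegral.integral_eq_sub_of_hasDerivAt (fun s _ => hder s)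
        (Continuous.intervalIntegrable (by fun_prop) _ _)]
      have : 0 ≤ κ⁻¹ * Real.exp (-κ * (r - 0)) := by positivity
      simp only [sub_self, mul_zero, Real.exp_zero, mul_one]
      linarith
    calc _ ≤ ∫ s in (0 : ℝ)..r, Real.exp (-κ * (r - s)) * (‖B‖ * ‖v‖) := by
          refine intervalIntegral.norm_integral_le_of_norm_le hr0
            (Eventually.of_forall fun s _ => ?_)
            (Continuous.intervalIntegrable (by fun_prop) _ _)
          rw [norm_smul, Real.norm_eq_abs, Real.abs_exp]
          gcongr
          exact (hS1' _ _).trans (B.le_opNorm_of_le (v.norm_coe_le_norm s))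
      _ ≤ κ⁻¹ * (‖B‖ * ‖v‖) := by
          rw [intervalIntegral.integral_mul_const]
          gcongr
      _ = _ := by ring
  let K : (ℝ →ᵇ X) →L[ℝ] (ℝ →ᵇ X) := LinearMap.mkContinuous
    { toFun := fun v => BoundedContinuousFunction.ofNormedAddCommGroup
        (fun t : ℝ => ∫ s in (0 : ℝ)..max t 0, Real.exp (-κ * (max t 0 - s)) •
          S (max (max t 0 - s) 0) (B (v s))) (hKcont v) (‖B‖ / κ * ‖v‖) (hKbound v)
      map_add' := fun v w => by
        ext t
        simp only [BoundedContinuousFunction.coe_ofNormedAddCommGroup,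
          BoundedContinuousFunction.coe_add, Pi.add_apply, map_add, smul_add]
        exact intervalIntegral.integral_add (hKint v t) (hKint w t)
      map_smul' := fun c v => by
        ext t
        simp only [BoundedContinuousFunction.coe_ofNormedAddCommGroup,
          BoundedContinuousFunction.coe_smul, map_smul, smul_comm _ c, RingHom.id_apply]
        exact intervalIntegral.integral_smul c _ } (‖B‖ / κ)
    (fun v => BoundedContinuousFunction.norm_ofNormedAddCommGroup_le _ (by positivity) (hKbound v))
  have hK : ‖-K‖ < 1 := by
    rw [norm_neg]
    refine (LinearMap.mkContinuous_norm_le _ (by positivity) _).trans_lt ?_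
    rw [div_lt_one hκ0, hκ]
    linarith
  -- L is the Neumann-series inverse of 1 + K. Solving by a bounded operator, not by a fixed point
  -- for each f, makes the solution linear and bounded in f.
  obtain ⟨L, hL⟩ : ∃ L : (ℝ →ᵇ X) →L[ℝ] (ℝ →ᵇ X), ∀ w, L w = w - K (L w) := by
    refine ⟨((Units.oneSub (-K) hK)⁻¹ : ((ℝ →ᵇ X) →L[ℝ] (ℝ →ᵇ X))ˣ).val, fun w => ?_⟩
    have h := congrArg (fun L : (ℝ →ᵇ X) →L[ℝ] (ℝ →ᵇ X) => L w) (Units.oneSub (-K) hK).mul_inv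
    simp only [Units.val_oneSub, sub_neg_eq_add, mul_apply_eq_comp, _root_.add_apply,
      one_apply_eq_self] at h
    exact eq_sub_of_add_eq h
  have happ : ∀ (v : ℝ →ᵇ X) (r : ℝ), 0 ≤ r → K v r = ∫ s in (0 : ℝ)..r,
      Real.exp (-κ * (r - s)) • S (max (r - s) 0) (B (v s)) := by
    intro v r hr
    change (∫ s in (0 : ℝ)..max r 0, Real.exp (-κ * (max r 0 - s)) •
      S (max (max r 0 - s) 0) (B (v s))) = _
    rw [max_eq_left hr]
  have hJ : ∀ (f : X) (r : ℝ), 0 ≤ r → J f r = Real.exp (-κ * r) • S r f := by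
    intro f r hr
    change Real.exp (-κ * max r 0) • S (max r 0) f = _
    rw [max_eq_left hr]
  -- The factor exp(κ t) undoes the weight.
  refine ⟨fun t => Real.exp (κ * max t 0) •
    (BoundedContinuousFunction.evalCLM ℝ (max t 0) ∘L L ∘L J), fun f => ?_, fun f t => ?_⟩
  · exact Continuous.smul (by fun_prop) ((L (J f)).continuous.comp
      (by fun_prop : Continuous fun t : ℝ => max t 0))
  · simp only [_root_.smul_apply, ContinuousLinearMap.comp_apply,
      BoundedContinuousFunction.evalCLM_apply]
    have hr : 0 ≤ max t 0 := le_max_right _ _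
    generalize max t 0 = r at hr ⊢
    have h1 : (L (J f)) r = J f r - K (L (J f)) r := by
      nth_rw 1 [hL (J f)]
      rfl
    rw [h1, happ _ _ hr, hJ _ _ hr, smul_sub, smul_smul, ← Real.exp_add, neg_mul, add_neg_cancel,
      Real.exp_zero, one_smul, ← intervalIntegral.integral_smul]
    congr 1
    refine intervalIntegral.integral_congr fun s hs => ?_
    rw [uIcc_of_le hr] at hs
    simp only [map_smul, smul_smul, max_eq_left hs.1]
    rw [← Real.exp_add]
    congr 2
    ring

/-- Bounded perturbation of the generator of a contraction semigroup. -/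
theorem exists_perturbed_semigroup (hS : StronglyContinuousSemigroup S)
    (hS1 : ∀ t, 0 ≤ t → ‖S t‖ ≤ 1) {G : X → X → Prop} (hG : Generates S G) (B : X →L[ℝ] X) :
    ∃ T : ℝ → X →L[ℝ] X, StronglyContinuousSemigroup T ∧
      Generates T fun f g => G f (g + B f) := by
  obtain ⟨T, hTc, hT⟩ := exists_volterra_solution hS hS1 B
  have hTt : ∀ (f : X) (t : ℝ), 0 ≤ t → T t f = S t f
      - ∫ s in (0 : ℝ)..t, S (max (t - s) 0) (B (T s f)) := by
    intro f t ht
    rw [hT f t, max_eq_left ht]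
  have hT0 : ∀ f, T 0 f = f := fun f => by
    rw [hTt f 0 le_rfl, intervalIntegral.integral_same, sub_zero, hS.map_zero_apply]
  have hint : ∀ (f : X) (t a b : ℝ), IntervalIntegrable
      (fun s => S (max (t - s) 0) (B (T s f))) volume a b := fun f t a b =>
    (hS.continuous_comp (by fun_prop) (B.continuous.comp (hTc f))).intervalIntegrable _ _
  refine ⟨T, ⟨ContinuousLinearMap.ext hT0, fun s t hs ht => ?_, fun f => (hTc f).continuousOn⟩, ?_⟩
  · ext1 f
    -- As functions of r, T (r + t) f and T r (T t f) solve the same Volterra equation: splitting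
    -- the integral at t, the part over [0, t] combines with S (r + t) f into S r (T t f).
    have hz := eq_zero_of_volterra hS1 B (d := fun r => T (r + t) f - T r (T t f))
      (((hTc f).comp (by fun_prop : Continuous fun r => r + t)).sub (hTc _)) ?_ s hs
    · exact sub_eq_zero.1 hz
    intro r hr
    have e1 : ∫ x in (0 : ℝ)..t, S (max (r + t - x) 0) (B (T x f))
        = S r (∫ x in (0 : ℝ)..t, S (max (t - x) 0) (B (T x f))) := by
      rw [← ContinuousLinearMap.intervalIntegral_comp_comm _ (hint _ _ _ _)]
      refine intervalIntegral.integral_congr fun x hx => ?_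
      rw [uIcc_of_le ht] at hx
      have hx' : 0 ≤ t - x := sub_nonneg.2 hx.2
      rw [max_eq_left hx', ← hS.map_add_apply hr hx', add_sub_assoc, max_eq_left (by linarith)]
    have e2 : ∫ x in t..r + t, S (max (r + t - x) 0) (B (T x f))
        = ∫ x in (0 : ℝ)..r, S (max (r - x) 0) (B (T (x + t) f)) := by
      have := intervalIntegral.integral_comp_add_right (a := 0) (b := r)
        (fun x => S (max (r + t - x) 0) (B (T x f))) t
      rw [zero_add] at this
      rw [← this]
      simp only [add_sub_add_right_eq_sub]
    have e3 := intervalIntegral.integral_add_adjacent_intervals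
      (hint f (r + t) 0 t) (hint f (r + t) t (r + t))
    have hint2 : IntervalIntegrable
        (fun x => S (max (r - x) 0) (B (T (x + t) f))) volume 0 r :=
      (hS.continuous_comp (by fun_prop) (B.continuous.comp ((hTc f).comp
        (by fun_prop : Continuous fun x => x + t)))).intervalIntegrable _ _
    simp only [map_sub]
    rw [intervalIntegral.integral_sub hint2 (hint _ _ _ _), hTt f (r + t) (by positivity), ← e3, e1,
      e2, hTt (T t f) r hr, hS.map_add_apply hr ht]
    have e4 := congrArg (S r) (hTt f t ht)
    rw [map_sub] at e4
    rw [e4]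
    abel
  · intro f g
    -- The difference quotients of S and T differ by this mean, so the generator of T is that of S
    -- minus B, on the same domain.
    have hlim : Tendsto (fun h : ℝ => h⁻¹ • ∫ s in (0 : ℝ)..h, S (max (h - s) 0) (B (T s f)))
        (𝓝[>] 0) (𝓝 (B f)) := by
      have := tendsto_inv_smul_integral (F := fun h s => S (max (h - s) 0) (B (T s f)))
        (hS.continuous_comp (by fun_prop) (B.continuous.comp ((hTc f).comp continuous_snd)))
      simpa [hT0, hS.map_zero_apply] using this
    refine (hG _ _).trans ?_
    constructor
    · intro h
      have := h.sub hlim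
      rw [add_sub_cancel_right] at this
      refine this.congr' ?_
      filter_upwards [self_mem_nhdsWithin] with h hh
      rw [hTt f h (le_of_lt hh), ← smul_sub, sub_right_comm]
    · intro h
      refine (h.add hlim).congr' ?_
      filter_upwards [self_mem_nhdsWithin] with h hh
      rw [hTt f h (le_of_lt hh), ← smul_add]
      congr 1
      abel

end Perturbation

/-! ### Weak derivatives on the Fourier side -/

section WeakDerivative

open scoped SchwartzMap FourierTransform LineDeriv

/-- The complex Hilbert space `L²(ℝ; ℂ)`. -/
abbrev ComplexL2 : Type := Lp ℂ 2 (volume : Measure ℝ)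

/-- `g` is the weak derivative of `f`, for complex-valued functions in `L²`. -/
def HasComplexWeakDeriv (f g : ComplexL2) : Prop :=
  ∀ φ : ℝ → ℝ, ContDiff ℝ ∞ φ → HasCompactSupport φ →
    ∫ x, deriv φ x • f x = -∫ x, φ x • g x

theorem integrable_smul_of_memLp {ρ : ℝ → ℝ} (hρ : MemLp ρ 2 volume) (f : ComplexL2) :
    Integrable (fun x => ρ x • f x) volume :=
  memLp_one_iff_integrable.1 ((Lp.memLp f).smul hρ)

/-- The weak derivative can be tested against smooth functions in `H¹`. -/
theorem HasComplexWeakDeriv.integral_deriv_smul {f g : ComplexL2} (h : HasComplexWeakDeriv f g)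
    {ρ : ℝ → ℝ} (hρ : ContDiff ℝ ∞ ρ) (hρ2 : MemLp ρ 2 volume) (hρ2' : MemLp (deriv ρ) 2 volume) :
    ∫ x, deriv ρ x • f x = -∫ x, ρ x • g x := by
  obtain ⟨χ, hχ, hχc, hχ0, hχabs⟩ : ∃ χ : ℝ → ℝ, ContDiff ℝ ∞ χ ∧ HasCompactSupport χ ∧
      χ 0 = 1 ∧ ∀ y, |χ y| ≤ 1 := by
    let χ : ContDiffBump (0 : ℝ) := ⟨1, 2, one_pos, one_lt_two⟩
    refine ⟨χ, χ.contDiff, χ.hasCompactSupport, χ.one_of_mem_closedBall (by simp [χ]), fun y => ?_⟩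
    rw [abs_of_nonneg χ.nonneg]
    exact χ.le_one
  have hχd : Continuous (deriv χ) := hχ.continuous_deriv (by simp)
  obtain ⟨C, hC⟩ := hχd.bounded_above_of_compact_support hχc.deriv
  set c : ℕ → ℝ := fun n => ((n : ℝ) + 1)⁻¹ with hc
  have hcpos : ∀ n, 0 < c n := fun n => by positivity
  have hcle : ∀ n, c n ≤ 1 := fun n => inv_le_one_of_one_le₀ (by simp)
  have hclim : Tendsto c atTop (𝓝 0) := by
    simpa [hc, one_div] using tendsto_one_div_add_atTop_nhds_zero_nat (𝕜 := ℝ)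
  -- Cut-offs χ(c n x) with c n → 0 make ρ compactly supported. The extra term in the derivative
  -- carries the factor c n and disappears in the limit.
  set φ : ℕ → ℝ → ℝ := fun n x => χ (c n * x) * ρ x with hφ
  have hφs : ∀ n, ContDiff ℝ ∞ (φ n) := fun n =>
    (hχ.comp (contDiff_const.mul contDiff_id)).mul hρ
  have hφc : ∀ n, HasCompactSupport (φ n) := fun n =>
    HasCompactSupport.mul_right (hχc.comp_homeomorph
      (Homeomorph.mulLeft₀ (c n) (hcpos n).ne'))
  have hφd : ∀ n x, deriv (φ n) x = c n * deriv χ (c n * x) * ρ x + χ (c n * x) * deriv ρ x := by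
    intro n x
    have h1 : HasDerivAt (fun x => χ (c n * x)) (deriv χ (c n * x) * c n) x :=
      HasDerivAt.comp x (hχ.differentiable (by simp) _).hasDerivAt
        (by simpa using (hasDerivAt_id x).const_mul (c n))
    have := (h1.mul (hρ.differentiable (by simp) x).hasDerivAt).deriv
    rw [mul_comm (c n)]
    exact this
  have hχlim : ∀ x : ℝ, Tendsto (fun n => χ (c n * x)) atTop (𝓝 1) := by
    intro x
    have h1 : Tendsto (fun n => c n * x) atTop (𝓝 0) := by simpa using hclim.mul_const x
    have h2 := (hχ.continuous.tendsto 0).comp h1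
    rwa [hχ0] at h2
  have l1 : Tendsto (fun n => ∫ x, deriv (φ n) x • f x) atTop (𝓝 (∫ x, deriv ρ x • f x)) := by
    refine tendsto_integral_of_dominated_convergence
      (fun x => C * ‖ρ x • f x‖ + ‖deriv ρ x • f x‖) (fun n => ?_)
      (((integrable_smul_of_memLp hρ2 f).norm.const_mul C).add
        (integrable_smul_of_memLp hρ2' f).norm) (fun n => ?_) ?_
    · exact ((hφs n).continuous_deriv (by simp)).aestronglyMeasurable.smul
        (Lp.aestronglyMeasurable f)
    · refine Eventually.of_forall fun x => ?_
      rw [hφd, add_smul, mul_smul _ (ρ x), mul_smul _ (deriv ρ x)]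
      refine (norm_add_le _ _).trans (add_le_add ?_ ?_)
      · rw [norm_smul]
        refine mul_le_mul_of_nonneg_right ?_ (norm_nonneg _)
        rw [norm_mul]
        refine (mul_le_of_le_one_left (norm_nonneg _) ?_).trans (hC _)
        rw [Real.norm_of_nonneg (hcpos n).le]
        exact hcle n
      · rw [norm_smul]
        exact mul_le_of_le_one_left (norm_nonneg _) (hχabs _)
    · refine Eventually.of_forall fun x => ?_
      simp only [hφd]
      have hz : Tendsto (fun n => c n * deriv χ (c n * x) * ρ x) atTop (𝓝 0) := by
        have h1 : Tendsto (fun n => c n * (C * |ρ x|)) atTop (𝓝 0) := by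
          simpa using hclim.mul_const (C * |ρ x|)
        refine squeeze_zero_norm (fun n => ?_) h1
        rw [norm_mul, norm_mul, Real.norm_of_nonneg (hcpos n).le, mul_assoc, Real.norm_eq_abs (ρ x)]
        have := (hcpos n).le
        gcongr
        exact hC _
      have := (hz.add ((hχlim x).mul_const (deriv ρ x))).smul_const (f x)
      simpa using this
  have l2 : Tendsto (fun n => -∫ x, φ n x • g x) atTop (𝓝 (-∫ x, ρ x • g x)) := by
    refine (tendsto_integral_of_dominated_convergence (fun x => ‖ρ x • g x‖) (fun n => ?_)
      (integrable_smul_of_memLp hρ2 g).norm (fun n => ?_) ?_).neg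
    · exact (hφs n).continuous.aestronglyMeasurable.smul (Lp.aestronglyMeasurable g)
    · refine Eventually.of_forall fun x => ?_
      rw [hφ]
      simp only
      rw [mul_smul, norm_smul]
      exact mul_le_of_le_one_left (norm_nonneg _) (hχabs _)
    · refine Eventually.of_forall fun x => ?_
      have := ((hχlim x).mul_const (ρ x)).smul_const (g x)
      simpa [hφ] using this
  exact tendsto_nhds_unique (l1.congr fun n => h (φ n) (hφs n) (hφc n)) l2

theorem schwartz_hasDerivAt (ψ : 𝓢(ℝ, ℂ)) (x : ℝ) : HasDerivAt ψ (∂_{(1 : ℝ)} ψ x) x :=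
  (ψ.differentiableAt (x := x)).hasFDerivAt.hasDerivAt

theorem memLp_clm_comp {ψ : 𝓢(ℝ, ℂ)} (L : ℂ →L[ℝ] ℝ) : MemLp (fun x => L (ψ x)) 2 volume :=
  (ψ.memLp 2 volume).continuousLinearMap_comp L

/-- Weak derivatives are tested against real functions, Schwartz functions are complex: L will be
the real or the imaginary part. -/
theorem HasComplexWeakDeriv.integral_clm {f g : ComplexL2} (h : HasComplexWeakDeriv f g)
    (ψ : 𝓢(ℝ, ℂ)) (L : ℂ →L[ℝ] ℝ) :
    ∫ x, L (∂_{(1 : ℝ)} ψ x) • f x = -∫ x, L (ψ x) • g x := by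
  have hd : deriv (fun x => L (ψ x)) = fun x => L (∂_{(1 : ℝ)} ψ x) :=
    funext fun x => (L.hasFDerivAt.comp_hasDerivAt x (schwartz_hasDerivAt ψ x)).deriv
  have := h.integral_deriv_smul (ρ := fun x => L (ψ x)) (L.contDiff.comp (ψ.smooth ⊤))
    (memLp_clm_comp L) (by rw [hd]; exact memLp_clm_comp L)
  rwa [hd] at this

theorem complex_integral_smul_eq (ψ : 𝓢(ℝ, ℂ)) (f : ComplexL2) :
    ∫ x, ψ x • f x = (∫ x, Complex.reCLM (ψ x) • f x)
      + Complex.I * ∫ x, Complex.imCLM (ψ x) • f x := by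
  rw [← integral_const_mul, ← integral_add (integrable_smul_of_memLp (memLp_clm_comp _) f)
    ((integrable_smul_of_memLp (memLp_clm_comp _) f).const_mul _)]
  congr 1
  ext1 x
  conv_lhs => rw [← Complex.re_add_im (ψ x)]
  simp only [Complex.reCLM_apply, Complex.imCLM_apply, smul_eq_mul, Complex.real_smul]
  ring

/-- The weak derivative is the derivative in the sense of tempered distributions. -/
theorem hasComplexWeakDeriv_iff_lineDeriv {f g : ComplexL2} :
    HasComplexWeakDeriv f g ↔ ∂_{(1 : ℝ)} (f : 𝓢'(ℝ, ℂ)) = (g : 𝓢'(ℝ, ℂ)) := by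
  constructor
  · intro h
    ext ψ
    rw [TemperedDistribution.lineDerivOp_apply_apply, map_neg, Lp.toTemperedDistribution_apply,
      Lp.toTemperedDistribution_apply, complex_integral_smul_eq, complex_integral_smul_eq,
      h.integral_clm, h.integral_clm]
    ring
  · intro h φ hφ hφc
    have hc : HasCompactSupport (Complex.ofRealCLM ∘ φ) := hφc.comp_left rfl
    have hs : ContDiff ℝ ∞ (Complex.ofRealCLM ∘ φ) := by fun_prop
    have h1 := congrArg (fun u : 𝓢'(ℝ, ℂ) => u (hc.toSchwartzMap hs)) h
    simp only [TemperedDistribution.lineDerivOp_apply_apply, map_neg,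
      Lp.toTemperedDistribution_apply] at h1
    have hd : ∀ x, ∂_{(1 : ℝ)} (hc.toSchwartzMap hs) x = ((deriv φ x : ℝ) : ℂ) := fun x =>
      (schwartz_hasDerivAt (hc.toSchwartzMap hs) x).unique
        ((hφ.differentiable (by simp) x).hasDerivAt.ofReal_comp)
    simp only [hd] at h1
    rw [neg_eq_iff_eq_neg] at h1
    simpa using h1

/-- Weak differentiation is multiplication by `2πiξ` on the Fourier side. -/
theorem hasComplexWeakDeriv_iff_fourier {f g : ComplexL2} :
    HasComplexWeakDeriv f g ↔
      ∀ᵐ ξ : ℝ, (𝓕 g : ComplexL2) ξ = (2 * Real.pi * ξ * Complex.I) * (𝓕 f : ComplexL2) ξ := by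
  have hinj : (∂_{(1 : ℝ)} (f : 𝓢'(ℝ, ℂ)) = (g : 𝓢'(ℝ, ℂ))) ↔
      𝓕 (∂_{(1 : ℝ)} (f : 𝓢'(ℝ, ℂ))) = 𝓕 (g : 𝓢'(ℝ, ℂ)) := by
    refine ⟨fun h => by rw [h], fun h => ?_⟩
    have := congrArg (fun u : 𝓢'(ℝ, ℂ) => 𝓕⁻ u) h
    simpa using this
  rw [hasComplexWeakDeriv_iff_lineDeriv, hinj, TemperedDistribution.fourier_lineDerivOp_eq,
    Lp.fourier_toTemperedDistribution_eq, Lp.fourier_toTemperedDistribution_eq]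
  have hval : ∀ ψ : 𝓢(ℝ, ℂ), ((2 * Real.pi * Complex.I) • TemperedDistribution.smulLeftCLM ℂ
      (fun x : ℝ => ((inner ℝ x 1 : ℝ) : ℂ)) ((𝓕 f : ComplexL2) : 𝓢'(ℝ, ℂ))) ψ
      = ∫ ξ, ψ ξ • ((2 * Real.pi * ξ * Complex.I) * (𝓕 f : ComplexL2) ξ) := by
    intro ψ
    have hg : (fun x : ℝ => ((inner ℝ x 1 : ℝ) : ℂ)).HasTemperateGrowth := by fun_prop
    change (2 * Real.pi * Complex.I) • (((𝓕 f : ComplexL2) : 𝓢'(ℝ, ℂ))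
      (SchwartzMap.smulLeftCLM ℂ (fun x : ℝ => ((inner ℝ x 1 : ℝ) : ℂ)) ψ)) = _
    rw [Lp.toTemperedDistribution_apply, ← integral_smul]
    congr 1
    ext1 ξ
    rw [SchwartzMap.smulLeftCLM_apply_apply hg]
    simp
    ring
  constructor
  · intro h
    -- The product ξ · 𝓕 f is not yet known to lie in L², so the two sides are compared as locally
    -- integrable functions.
    refine ae_eq_of_integral_contDiff_smul_eq
      ((Lp.memLp (𝓕 g : ComplexL2)).locallyIntegrable (by norm_num)) ?_ ?_
    · exact ((Lp.memLp (𝓕 f : ComplexL2)).locallyIntegrable (by norm_num)).continuous_smul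
        (g := fun ξ : ℝ => (2 * Real.pi * ξ * Complex.I : ℂ)) (by fun_prop)
    · intro φ hφ hφc
      have hc : HasCompactSupport (Complex.ofRealCLM ∘ φ) := hφc.comp_left rfl
      have hs : ContDiff ℝ ∞ (Complex.ofRealCLM ∘ φ) := by fun_prop
      have h1 := congrArg (fun u : 𝓢'(ℝ, ℂ) => u (hc.toSchwartzMap hs)) h
      rw [hval, Lp.toTemperedDistribution_apply] at h1
      simpa using h1.symm
  · intro h
    ext ψ
    rw [hval, Lp.toTemperedDistribution_apply]
    refine integral_congr_ae ?_
    filter_upwards [h] with ξ hξ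
    rw [hξ]

end WeakDerivative

/-! ### Multiplication semigroups on L² -/

section FourierMultiplier

/-- Dominated convergence in `L²`. -/
theorem tendsto_L2_of_dominated {ι : Type*} {l : Filter ι} [l.IsCountablyGenerated]
    {F : ι → ComplexL2} {F' : ι → ℝ → ℂ} {f : ComplexL2} {b : ℝ → ℝ}
    (hF : ∀ᶠ i in l, F i =ᵐ[volume] F' i) (hb : MemLp b 2 volume)
    (hbound : ∀ᶠ i in l, ∀ᵐ x, ‖F' i x‖ ≤ b x)
    (hlim : ∀ᵐ x, Tendsto (fun i => F' i x) l (𝓝 (f x))) : Tendsto F l (𝓝 f) := by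
  have hnorm : ∀ u : ComplexL2, ‖u‖ ^ 2 = ∫ x, ‖u x‖ ^ 2 := by
    intro u
    have h := congrArg Complex.re (L2.inner_def (𝕜 := ℂ) u u)
    rw [inner_self_eq_norm_sq_to_K] at h
    simp only [inner_self_eq_norm_sq_to_K] at h
    have h2 : ∫ x, ((‖u x‖ : ℂ)) ^ 2 = ((∫ x, ‖u x‖ ^ 2 : ℝ) : ℂ) := by
      simp only [← Complex.ofReal_pow]
      exact integral_ofReal
    change (((‖u‖ : ℝ) : ℂ) ^ 2).re = (∫ x, ((‖u x‖ : ℂ)) ^ 2).re at h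
    rwa [h2, ← Complex.ofReal_pow, Complex.ofReal_re, Complex.ofReal_re] at h
  have key : Tendsto (fun i => ‖F i - f‖ ^ 2) l (𝓝 0) := by
    have hbf : MemLp (fun x => b x + ‖f x‖) 2 volume := hb.add (Lp.memLp f).norm
    have h0 : Tendsto (fun i => ∫ x, ‖(F i - f : ComplexL2) x‖ ^ 2) l (𝓝 (∫ _ : ℝ, (0 : ℝ))) := by
      have : Tendsto (fun i => ∫ x, ‖F' i x - f x‖ ^ 2) l (𝓝 (∫ _ : ℝ, (0 : ℝ))) := by
        refine tendsto_integral_filter_of_dominated_convergence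
          (fun x => (b x + ‖f x‖) ^ 2) ?_ ?_ hbf.integrable_sq ?_
        · filter_upwards [hF] with i hi
          have : AEStronglyMeasurable (F' i) volume :=
            (Lp.aestronglyMeasurable (F i)).congr hi
          exact ((this.sub (Lp.aestronglyMeasurable f)).norm.pow 2)
        · filter_upwards [hbound] with i hi
          filter_upwards [hi] with x hx
          rw [Real.norm_of_nonneg (by positivity)]
          have := norm_sub_le (F' i x) (f x)
          gcongr
          linarith
        · filter_upwards [hlim] with x hx
          have := ((hx.sub_const (f x)).norm).pow 2
          simpa using this
      refine this.congr' ?_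
      filter_upwards [hF] with i hi
      refine integral_congr_ae ?_
      filter_upwards [hi, Lp.coeFn_sub (F i) f] with x h1 h2
      rw [h2, Pi.sub_apply, h1]
    rw [integral_zero] at h0
    exact h0.congr fun i => (hnorm _).symm
  rw [tendsto_iff_norm_sub_tendsto_zero]
  have := key.sqrt
  simpa using this

theorem memLp_mul_of_norm_le_one {m : ℝ → ℂ} (hm : Continuous m) (h1 : ∀ ξ, ‖m ξ‖ ≤ 1)
    (f : ComplexL2) : MemLp (fun ξ => m ξ * f ξ) 2 volume :=
  (Lp.memLp f).of_le (hm.aestronglyMeasurable.mul (Lp.aestronglyMeasurable f))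
    (Eventually.of_forall fun ξ => by
      rw [norm_mul]; exact mul_le_of_le_one_left (norm_nonneg _) (h1 ξ))

/-- Multiplication by a continuous function bounded by one, as an operator on `L²`. -/
noncomputable def contractionMul (m : ℝ → ℂ) (hm : Continuous m) (h1 : ∀ ξ, ‖m ξ‖ ≤ 1) :
    ComplexL2 →L[ℝ] ComplexL2 :=
  LinearMap.mkContinuous
    { toFun := fun f => (memLp_mul_of_norm_le_one hm h1 f).toLp
      map_add' := fun f g => by
        ext1
        filter_upwards [(memLp_mul_of_norm_le_one hm h1 (f + g)).coeFn_toLp, (memLp_mul_of_norm_le_one hm h1 f).coeFn_toLp, (memLp_mul_of_norm_le_one hm h1 g).coeFn_toLp,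
          Lp.coeFn_add f g, Lp.coeFn_add (memLp_mul_of_norm_le_one hm h1 f).toLp (memLp_mul_of_norm_le_one hm h1 g).toLp] with ξ e1 e2 e3 e4 e5
        rw [e1, e5, Pi.add_apply, e2, e3, e4, Pi.add_apply, mul_add]
      map_smul' := fun c f => by
        ext1
        filter_upwards [(memLp_mul_of_norm_le_one hm h1 (c • f)).coeFn_toLp, (memLp_mul_of_norm_le_one hm h1 f).coeFn_toLp,
          Lp.coeFn_smul c f, Lp.coeFn_smul c (memLp_mul_of_norm_le_one hm h1 f).toLp] with ξ e1 e2 e3 e4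
        rw [e1, RingHom.id_apply, e4, Pi.smul_apply, e2, e3, Pi.smul_apply, mul_smul_comm] } 1
    fun f => by
      rw [one_mul]
      refine Lp.norm_le_norm_of_ae_le ?_
      filter_upwards [(memLp_mul_of_norm_le_one hm h1 f).coeFn_toLp] with ξ e
      change ‖(memLp_mul_of_norm_le_one hm h1 f).toLp _ ξ‖ ≤ _
      rw [e, norm_mul]
      exact mul_le_of_le_one_left (norm_nonneg _) (h1 ξ)

theorem coeFn_contractionMul (m : ℝ → ℂ) (hm : Continuous m) (h1 : ∀ ξ, ‖m ξ‖ ≤ 1)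
    (f : ComplexL2) : contractionMul m hm h1 f =ᵐ[volume] fun ξ => m ξ * f ξ :=
  (memLp_mul_of_norm_le_one hm h1 f).coeFn_toLp

theorem norm_contractionMul_le (m : ℝ → ℂ) (hm : Continuous m) (h1 : ∀ ξ, ‖m ξ‖ ≤ 1) :
    ‖contractionMul m hm h1‖ ≤ 1 :=
  LinearMap.mkContinuous_norm_le (C := 1) _ zero_le_one _

theorem norm_exp_mul_le_one {t : ℝ} (ht : 0 ≤ t) {z : ℂ} (hz : z.re ≤ 0) :
    ‖Complex.exp (t * z)‖ ≤ 1 := by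
  rw [Complex.norm_exp, Real.exp_le_one_iff]
  simpa using mul_nonpos_of_nonneg_of_nonpos ht hz

/-- Mean value inequality on the convex left half-plane, where |exp| ≤ 1. It bounds |exp(h p) - 1| /
h by |p| uniformly in h > 0. -/
theorem norm_exp_sub_one_le_of_re_nonpos {z : ℂ} (hz : z.re ≤ 0) : ‖Complex.exp z - 1‖ ≤ ‖z‖ := by
  have := (convex_halfSpace_re_le 0).norm_image_sub_le_of_norm_hasDerivWithin_le
    (f := Complex.exp) (C := 1) (fun x _ => (Complex.hasDerivAt_exp x).hasDerivWithinAt)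
    (fun x hx => by rw [Complex.norm_exp, Real.exp_le_one_iff]; exact hx)
    (show (0 : ℂ) ∈ {c : ℂ | c.re ≤ 0} by simp) (show z ∈ {c : ℂ | c.re ≤ 0} from hz)
  simpa using this

variable {p : ℝ → ℂ} (hp : Continuous p) (hre : ∀ ξ, (p ξ).re ≤ 0)

/-- The semigroup of multiplications by `exp (t p)`, where `p` has non-positive real part. -/
noncomputable def mulSemigroup (t : ℝ) : ComplexL2 →L[ℝ] ComplexL2 :=
  contractionMul (fun ξ => Complex.exp ((max t 0 : ℝ) * p ξ)) (by fun_prop)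
    fun ξ => norm_exp_mul_le_one (le_max_right _ _) (hre ξ)

theorem coeFn_mulSemigroup {t : ℝ} (ht : 0 ≤ t) (f : ComplexL2) :
    mulSemigroup hp hre t f =ᵐ[volume] fun ξ => Complex.exp (t * p ξ) * f ξ := by
  have := coeFn_contractionMul (fun ξ => Complex.exp ((max t 0 : ℝ) * p ξ)) (by fun_prop)
    (fun ξ => norm_exp_mul_le_one (le_max_right _ _) (hre ξ)) f
  filter_upwards [this] with ξ h
  exact h.trans (by rw [max_eq_left ht])

theorem norm_mulSemigroup_le (t : ℝ) : ‖mulSemigroup hp hre t‖ ≤ 1 :=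
  norm_contractionMul_le _ _ _

theorem stronglyContinuousSemigroup_mul :
    StronglyContinuousSemigroup (mulSemigroup hp hre) where
  map_zero := by
    ext1 f
    ext1
    filter_upwards [coeFn_mulSemigroup hp hre le_rfl f] with ξ h
    rw [h]
    simp
  map_add s t hs ht := by
    ext1 f
    ext1
    filter_upwards [coeFn_mulSemigroup hp hre (add_nonneg hs ht) f,
      coeFn_mulSemigroup hp hre hs (mulSemigroup hp hre t f),
      coeFn_mulSemigroup hp hre ht f] with ξ h1 h2 h3
    rw [ContinuousLinearMap.comp_apply, h1, h2, h3, ← mul_assoc, ← Complex.exp_add]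
    push_cast
    ring_nf
  continuousOn f := by
    intro t ht
    refine tendsto_L2_of_dominated (F' := fun (t : ℝ) ξ => Complex.exp (t * p ξ) * f ξ)
      (b := fun ξ => ‖f ξ‖) ?_ (Lp.memLp f).norm ?_ ?_
    · filter_upwards [self_mem_nhdsWithin] with s hs
      exact coeFn_mulSemigroup hp hre hs f
    · filter_upwards [self_mem_nhdsWithin] with s hs
      refine Eventually.of_forall fun ξ => ?_
      rw [norm_mul]
      exact mul_le_of_le_one_left (norm_nonneg _) (norm_exp_mul_le_one hs (hre ξ))
    · filter_upwards [coeFn_mulSemigroup hp hre ht f] with ξ h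
      rw [h]
      have : Continuous fun t : ℝ => Complex.exp (t * p ξ) * f ξ := by fun_prop
      exact this.continuousWithinAt

/-- The quotients (exp(h p) - 1) f / h converge pointwise to p f. If p f = g lies in L², then |g|
dominates them and convergence holds in L². -/
theorem generates_mulSemigroup :
    Generates (mulSemigroup hp hre) fun f g => ∀ᵐ ξ, g ξ = p ξ * f ξ := by
  intro f g
  have hq : ∀ h : ℝ, 0 < h → (h⁻¹ • (mulSemigroup hp hre h f - f) : ComplexL2) =ᵐ[volume]
      fun ξ => (h : ℂ)⁻¹ * (Complex.exp (h * p ξ) - 1) * f ξ := by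
    intro h hh
    filter_upwards [coeFn_mulSemigroup hp hre hh.le f, Lp.coeFn_sub (mulSemigroup hp hre h f) f,
      Lp.coeFn_smul h⁻¹ (mulSemigroup hp hre h f - f)] with ξ h1 h2 h3
    rw [h3, Pi.smul_apply, h2, Pi.sub_apply, h1, Complex.real_smul]
    push_cast
    ring
  have hlim : ∀ ξ, Tendsto (fun h : ℝ => (h : ℂ)⁻¹ * (Complex.exp (h * p ξ) - 1) * f ξ)
      (𝓝[>] 0) (𝓝 (p ξ * f ξ)) := by
    intro ξ
    have hd : HasDerivAt (fun h : ℝ => Complex.exp (h * p ξ)) (p ξ) 0 := by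
      have h1 : HasDerivAt (fun h : ℝ => (h : ℂ) * p ξ) (1 * p ξ) 0 :=
        (HasDerivAt.ofReal_comp (hasDerivAt_id (0 : ℝ))).mul_const (p ξ)
      simpa using h1.cexp
    have h2 := (hasDerivWithinAt_iff_tendsto_slope' (s := Ioi (0 : ℝ)) (by simp)).1
      hd.hasDerivWithinAt
    refine (h2.mul_const (f ξ)).congr fun h => ?_
    simp [slope_def_module, Complex.real_smul]
  constructor
  · intro hg
    refine tendsto_L2_of_dominated (b := fun ξ => ‖g ξ‖)
      (F' := fun (h : ℝ) ξ => (h : ℂ)⁻¹ * (Complex.exp (h * p ξ) - 1) * f ξ) ?_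
      (Lp.memLp g).norm ?_ ?_
    · filter_upwards [self_mem_nhdsWithin] with h hh using hq h hh
    · filter_upwards [self_mem_nhdsWithin] with h hh
      have hh : 0 < h := hh
      filter_upwards [hg] with ξ hξ
      rw [hξ, norm_mul, norm_mul, norm_mul, norm_inv, Complex.norm_real,
        Real.norm_of_nonneg hh.le]
      gcongr
      rw [inv_mul_le_iff₀ hh]
      refine (norm_exp_sub_one_le_of_re_nonpos ?_).trans ?_
      · simpa using mul_nonpos_of_nonneg_of_nonpos hh.le (hre ξ)
      · rw [norm_mul, Complex.norm_real, Real.norm_of_nonneg hh.le]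
    · filter_upwards [hg] with ξ hξ
      rw [hξ]
      exact hlim ξ
  · intro hg
    -- Conversely, an L² limit is an almost everywhere limit along a sequence, which identifies it
    -- as p f.
    obtain ⟨n, hn, hae⟩ := (tendstoInMeasure_of_tendsto_Lp hg).exists_seq_tendsto_ae'
    have hpos : ∀ᶠ i in atTop, 0 < n i := hn.eventually self_mem_nhdsWithin
    have hall : ∀ᵐ ξ, ∀ i, 0 < n i →
        ((n i)⁻¹ • (mulSemigroup hp hre (n i) f - f) : ComplexL2) ξ
          = ((n i : ℝ) : ℂ)⁻¹ * (Complex.exp ((n i : ℝ) * p ξ) - 1) * f ξ := by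
      rw [ae_all_iff]
      intro i
      by_cases hi : 0 < n i
      · filter_upwards [hq _ hi] with ξ h _ using h
      · exact Eventually.of_forall fun ξ h => absurd h hi
    filter_upwards [hae, hall] with ξ h1 h2
    refine tendsto_nhds_unique h1 (((hlim ξ).comp hn).congr' ?_)
    filter_upwards [hpos] with i hi
    exact (h2 i hi).symm

end FourierMultiplier

/-! ### The operator A_{λ₀} and its semigroup -/

section KdVBurgers

open scoped FourierTransform

/-- The graph of `f ↦ -f_{xxx} + f_{xx}` on `L²(ℝ; ℂ)` with domain `H³`. -/
def ComplexGraph (f g : ComplexL2) : Prop :=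
  ∃ f₁ f₂ f₃ : ComplexL2, HasComplexWeakDeriv f f₁ ∧ HasComplexWeakDeriv f₁ f₂ ∧
    HasComplexWeakDeriv f₂ f₃ ∧ g = -f₃ + f₂

/-- The Fourier symbol of `f ↦ -f_{xxx} + f_{xx}`. -/
noncomputable def symbol (ξ : ℝ) : ℂ :=
  -(2 * Real.pi * ξ * Complex.I) ^ 3 + (2 * Real.pi * ξ * Complex.I) ^ 2

theorem continuous_symbol : Continuous symbol := by
  unfold symbol
  fun_prop

theorem symbol_eq (ξ : ℝ) :
    symbol ξ = ((-(2 * Real.pi * ξ) ^ 2 : ℝ) : ℂ) + ((2 * Real.pi * ξ) ^ 3 : ℝ) * Complex.I := by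
  rw [symbol, mul_pow, mul_pow _ Complex.I, Complex.I_sq, Complex.I_pow_three]
  push_cast
  ring

theorem symbol_re (ξ : ℝ) : (symbol ξ).re = -(2 * Real.pi * ξ) ^ 2 := by
  rw [symbol_eq, Complex.add_re, Complex.ofReal_re, Complex.re_ofReal_mul, Complex.I_re, mul_zero,
    add_zero]

theorem symbol_im (ξ : ℝ) : (symbol ξ).im = (2 * Real.pi * ξ) ^ 3 := by
  rw [symbol_eq, Complex.add_im, Complex.ofReal_im, Complex.im_ofReal_mul, Complex.I_im, mul_one,
    zero_add]

theorem symbol_re_nonpos (ξ : ℝ) : (symbol ξ).re ≤ 0 := by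
  rw [symbol_re]
  nlinarith [sq_nonneg (2 * Real.pi * ξ)]

/-- The imaginary part of the symbol is (2πξ)³, so the dispersive term alone controls every power up
to the third. Hence f and its image in L² force all three derivatives into L². -/
theorem norm_pow_le_one_add_norm_symbol (ξ : ℝ) {j : ℕ} (hj : j ≤ 3) :
    ‖(2 * Real.pi * ξ * Complex.I : ℂ) ^ j‖ ≤ 1 + ‖symbol ξ‖ := by
  have h1 : ‖(2 * Real.pi * ξ * Complex.I : ℂ)‖ = |2 * Real.pi * ξ| := by
    rw [norm_mul, Complex.norm_I, mul_one, ← Real.norm_eq_abs, ← Complex.norm_real]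
    push_cast
    rfl
  have h2 : |2 * Real.pi * ξ| ^ 3 ≤ ‖symbol ξ‖ := by
    rw [← abs_pow, ← symbol_im]
    exact Complex.abs_im_le_norm _
  rw [norm_pow, h1]
  rcases le_total |2 * Real.pi * ξ| 1 with h | h
  · have := pow_le_one₀ (n := j) (abs_nonneg _) h
    have := norm_nonneg (symbol ξ)
    linarith
  · have := pow_le_pow_right₀ h hj
    linarith

theorem complexGraph_iff_symbol {f g : ComplexL2} :
    ComplexGraph f g ↔ ∀ᵐ ξ : ℝ, (𝓕 g : ComplexL2) ξ = symbol ξ * (𝓕 f : ComplexL2) ξ := by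
  have hF : ∀ u v : ComplexL2, 𝓕 (-u + v) = -𝓕 u + 𝓕 v := fun u v => by
    have h := (Lp.fourierTransformₗᵢ ℝ ℂ).map_add (-u) v
    rw [map_neg] at h
    exact h
  have hsum : ∀ u v : ComplexL2, ∀ᵐ ξ : ℝ, (-u + v : ComplexL2) ξ = -u ξ + v ξ := fun u v => by
    filter_upwards [Lp.coeFn_add (-u) v, Lp.coeFn_neg u] with ξ h1 h2
    rw [h1, Pi.add_apply, h2, Pi.neg_apply]
  constructor
  · rintro ⟨f₁, f₂, f₃, h1, h2, h3, rfl⟩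
    rw [hasComplexWeakDeriv_iff_fourier] at h1 h2 h3
    rw [hF]
    filter_upwards [h1, h2, h3, hsum (𝓕 f₃) (𝓕 f₂)] with ξ e1 e2 e3 e4
    rw [e4, e3, e2, e1, symbol]
    ring
  · intro h
    have hmem : ∀ j : ℕ, j ≤ 3 → MemLp (fun ξ : ℝ =>
        (2 * Real.pi * ξ * Complex.I) ^ j * (𝓕 f : ComplexL2) ξ) 2 volume := by
      intro j hj
      have hc : Continuous fun ξ : ℝ => (2 * Real.pi * ξ * Complex.I : ℂ) ^ j := by fun_prop
      refine ((Lp.memLp (𝓕 f : ComplexL2)).norm.add (Lp.memLp (𝓕 g : ComplexL2)).norm).of_le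
        (hc.aestronglyMeasurable.mul (Lp.aestronglyMeasurable _)) ?_
      filter_upwards [h] with ξ hξ
      rw [norm_mul, Pi.add_apply, hξ, norm_mul, ← one_add_mul, Real.norm_of_nonneg (by positivity)]
      gcongr
      exact norm_pow_le_one_add_norm_symbol ξ hj
    have hex : ∀ j : ℕ, j ≤ 3 → ∃ u : ComplexL2, ∀ᵐ ξ : ℝ, (𝓕 u : ComplexL2) ξ
        = (2 * Real.pi * ξ * Complex.I) ^ j * (𝓕 f : ComplexL2) ξ := by
      intro j hj
      refine ⟨𝓕⁻ ((hmem j hj).toLp _), ?_⟩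
      rw [FourierTransform.fourier_fourierInv_eq]
      exact (hmem j hj).coeFn_toLp
    obtain ⟨f₁, h1⟩ := hex 1 (by norm_num)
    obtain ⟨f₂, h2⟩ := hex 2 (by norm_num)
    obtain ⟨f₃, h3⟩ := hex 3 le_rfl
    refine ⟨f₁, f₂, f₃, ?_, ?_, ?_, ?_⟩
    · rw [hasComplexWeakDeriv_iff_fourier]
      filter_upwards [h1] with ξ e1
      rw [e1, pow_one]
    · rw [hasComplexWeakDeriv_iff_fourier]
      filter_upwards [h1, h2] with ξ e1 e2
      rw [e1, e2]
      ring
    · rw [hasComplexWeakDeriv_iff_fourier]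
      filter_upwards [h2, h3] with ξ e2 e3
      rw [e2, e3]
      ring
    · apply (Lp.fourierTransformₗᵢ ℝ ℂ).injective
      change 𝓕 g = 𝓕 (-f₃ + f₂)
      rw [hF]
      ext1
      filter_upwards [h, h2, h3, hsum (𝓕 f₃) (𝓕 f₂)] with ξ e1 e2 e3 e4
      rw [e4, e3, e2, e1, symbol]
      ring

/-- The linear KdV--Burgers operator generates a contraction semigroup on `L²(ℝ; ℂ)`. -/
theorem exists_complex_semigroup : ∃ S : ℝ → ComplexL2 →L[ℝ] ComplexL2,
    StronglyContinuousSemigroup S ∧ Generates S ComplexGraph ∧ ∀ t, ‖S t‖ ≤ 1 := by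
  let F : ComplexL2 ≃ₗᵢ[ℂ] ComplexL2 := Lp.fourierTransformₗᵢ ℝ ℂ
  let e : ComplexL2 ≃L[ℝ] ComplexL2 := F.toContinuousLinearEquiv.restrictScalars ℝ
  have hS := stronglyContinuousSemigroup_mul continuous_symbol symbol_re_nonpos
  have hG := generates_mulSemigroup continuous_symbol symbol_re_nonpos
  refine ⟨_, hS.conj e, fun f g => ?_, fun t => ?_⟩
  · rw [complexGraph_iff_symbol]
    exact StronglyContinuousSemigroup.generates_conj hG e f g
  · refine ContinuousLinearMap.opNorm_le_bound _ zero_le_one fun f => ?_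
    have h1 : ∀ u, ‖e u‖ = ‖u‖ := F.norm_map
    have h2 : ∀ u, ‖e.symm u‖ = ‖u‖ := F.symm.norm_map
    change ‖e.symm (mulSemigroup continuous_symbol symbol_re_nonpos t (e f))‖ ≤ 1 * ‖f‖
    rw [h2, ← h1 f]
    exact ContinuousLinearMap.le_of_opNorm_le _ (norm_mulSemigroup_le _ _ t) _

/-- The embedding of real-valued into complex-valued functions. -/
noncomputable def toComplexL2 : L2 →L[ℝ] ComplexL2 := Complex.ofRealCLM.compLpL 2 volume

/-- The real part. -/
noncomputable def reL2 : ComplexL2 →L[ℝ] L2 := Complex.reCLM.compLpL 2 volume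

theorem coeFn_toComplexL2 (f : L2) : toComplexL2 f =ᵐ[volume] fun x => (f x : ℂ) :=
  Complex.ofRealCLM.coeFn_compLpL f

theorem coeFn_reL2 (f : ComplexL2) : reL2 f =ᵐ[volume] fun x => (f x).re :=
  Complex.reCLM.coeFn_compLpL f

theorem reL2_toComplexL2 (f : L2) : reL2 (toComplexL2 f) = f := by
  ext1
  filter_upwards [coeFn_reL2 (toComplexL2 f), coeFn_toComplexL2 f] with x h1 h2
  rw [h1, h2, Complex.ofReal_re]

theorem coeFn_conj (f : ComplexL2) :
    (Complex.conjCLE : ℂ →L[ℝ] ℂ).compLpL 2 volume f =ᵐ[volume] fun x => star (f x) :=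
  (Complex.conjCLE : ℂ →L[ℝ] ℂ).coeFn_compLpL f

/-- Complex conjugation on `L²(ℝ; ℂ)`. -/
noncomputable def conjL2 : ComplexL2 ≃L[ℝ] ComplexL2 :=
  have h : Function.LeftInverse ((Complex.conjCLE : ℂ →L[ℝ] ℂ).compLpL 2 (volume : Measure ℝ))
      ((Complex.conjCLE : ℂ →L[ℝ] ℂ).compLpL 2 volume) := fun f => by
    ext1
    filter_upwards [coeFn_conj f,
      coeFn_conj ((Complex.conjCLE : ℂ →L[ℝ] ℂ).compLpL 2 volume f)] with x h1 h2
    rw [h2, h1, star_star]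
  ContinuousLinearEquiv.equivOfInverse ((Complex.conjCLE : ℂ →L[ℝ] ℂ).compLpL 2 volume)
    ((Complex.conjCLE : ℂ →L[ℝ] ℂ).compLpL 2 volume) h h

theorem coeFn_conjL2 (f : ComplexL2) : conjL2 f =ᵐ[volume] fun x => star (f x) := coeFn_conj f

theorem conjL2_conjL2 (f : ComplexL2) : conjL2 (conjL2 f) = f := conjL2.symm_apply_apply f

theorem conjL2_toComplexL2 (f : L2) : conjL2 (toComplexL2 f) = toComplexL2 f := by
  ext1
  filter_upwards [coeFn_conjL2 (toComplexL2 f), coeFn_toComplexL2 f] with x h1 h2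
  rw [h1, h2]
  exact Complex.conj_ofReal _

theorem toComplexL2_reL2 {f : ComplexL2} (hf : conjL2 f = f) : toComplexL2 (reL2 f) = f := by
  ext1
  have hc := coeFn_conjL2 f
  rw [hf] at hc
  filter_upwards [coeFn_toComplexL2 (reL2 f), coeFn_reL2 f, hc] with x h1 h2 h3
  rw [h1, h2]
  exact Complex.conj_eq_iff_re.1 h3.symm

theorem integrable_smul_test {φ : ℝ → ℝ} (hφ : Continuous φ) (hc : HasCompactSupport φ)
    (f : ComplexL2) : Integrable (fun x => φ x • f x) volume :=
  integrable_smul_of_memLp (hφ.memLp_of_hasCompactSupport hc) f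

theorem HasComplexWeakDeriv.conj {f g : ComplexL2} (h : HasComplexWeakDeriv f g) :
    HasComplexWeakDeriv (conjL2 f) (conjL2 g) := by
  intro φ hφ hc
  have key : ∀ (ρ : ℝ → ℝ) (u : ComplexL2),
      ∫ x, ρ x • conjL2 u x = star (∫ x, ρ x • u x) := by
    intro ρ u
    refine Eq.trans ?_ (integral_conj (f := fun x => ρ x • u x))
    refine integral_congr_ae ?_
    filter_upwards [coeFn_conjL2 u] with x hx
    rw [hx]
    simp
  rw [key, key, h φ hφ hc, star_neg]

theorem HasWeakDeriv.toComplex {f g : L2} (h : HasWeakDeriv f g) :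
    HasComplexWeakDeriv (toComplexL2 f) (toComplexL2 g) := by
  intro φ hφ hc
  have key : ∀ (ρ : ℝ → ℝ) (u : L2),
      ∫ x, ρ x • toComplexL2 u x = ((∫ x, u x * ρ x : ℝ) : ℂ) := by
    intro ρ u
    refine Eq.trans ?_ integral_ofReal
    refine integral_congr_ae ?_
    filter_upwards [coeFn_toComplexL2 u] with x hx
    rw [hx]
    simp [mul_comm]
  rw [key, key, h φ hφ hc, Complex.ofReal_neg]

theorem HasComplexWeakDeriv.re {f g : ComplexL2} (h : HasComplexWeakDeriv f g) :
    HasWeakDeriv (reL2 f) (reL2 g) := by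
  intro φ hφ hc
  have key : ∀ (ρ : ℝ → ℝ) (u : ComplexL2), Integrable (fun x => ρ x • u x) volume →
      ∫ x, reL2 u x * ρ x = (∫ x, ρ x • u x).re := by
    intro ρ u hi
    refine Eq.trans ?_ (integral_re hi)
    refine integral_congr_ae ?_
    filter_upwards [coeFn_reL2 u] with x hx
    rw [hx]
    simp [mul_comm]
  rw [key _ _ (integrable_smul_test (hφ.continuous_deriv (by simp)) hc.deriv f),
    key _ _ (integrable_smul_test hφ.continuous hc g), h φ hφ hc, Complex.neg_re]

theorem ComplexGraph.conj {f g : ComplexL2} (h : ComplexGraph f g) :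
    ComplexGraph (conjL2 f) (conjL2 g) := by
  obtain ⟨f₁, f₂, f₃, h1, h2, h3, rfl⟩ := h
  exact ⟨_, _, _, h1.conj, h2.conj, h3.conj, by rw [map_add, map_neg]⟩

/-- Conjugation commutes with the operator because its coefficients and the test functions are real.
-/
theorem complexGraph_conj_iff {f g : ComplexL2} :
    ComplexGraph (conjL2 f) (conjL2 g) ↔ ComplexGraph f g :=
  ⟨fun h => by simpa only [conjL2_conjL2] using h.conj, fun h => h.conj⟩

/-- Pointwise multiplication by an element of `L^∞` as a bounded operator on `L²`. -/
noncomputable def mulL (a : LInf) : L2 →L[ℝ] L2 :=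
  LinearMap.mkContinuous
    { toFun := fun f => (a • f : L2)
      map_add' := fun f g => Lp.add_smul a f g
      map_smul' := fun c f => (Lp.smul_comm c a f).symm } ‖a‖ fun f => Lp.norm_smul_le a f

theorem mulL_apply (a : LInf) (f : L2) : mulL a f = (a • f : L2) := rfl

/-- This is the shape G f (g + B f) produced by `exists_perturbed_semigroup`. Backwards, the complex
derivatives need not be known to be real: their real parts serve. -/
theorem graphA_iff {lam0 : LInf} {f g : L2} :
    GraphA lam0 f g ↔ ComplexGraph (toComplexL2 f) (toComplexL2 (g + mulL lam0 f)) := by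
  constructor
  · rintro ⟨f₁, f₂, f₃, h1, h2, h3, rfl⟩
    refine ⟨_, _, _, h1.toComplex, h2.toComplex, h3.toComplex, ?_⟩
    rw [mulL_apply, sub_add_cancel, map_add, map_neg]
  · rintro ⟨f₁, f₂, f₃, h1, h2, h3, h4⟩
    have h1 := h1.re
    rw [reL2_toComplexL2] at h1
    have h4 := congrArg reL2 h4
    rw [reL2_toComplexL2, map_add, map_neg] at h4
    exact ⟨_, _, _, h1, h2.re, h3.re, eq_sub_of_add_eq h4⟩

/-- `A_{λ₀}` generates a strongly continuous semigroup on `L²(ℝ)`. -/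
theorem exists_semigroup (lam0 : LInf) : ∃ S : ℝ → L2 →L[ℝ] L2,
    StronglyContinuousSemigroup S ∧ Generates S (GraphA lam0) := by
  obtain ⟨S, hS, hG, hS1⟩ := exists_complex_semigroup
  -- The conjugated semigroup has the same generator, hence equals S; so S maps real functions to
  -- functions fixed by conjugation, that is, to real ones.
  have hGc : Generates (fun t => (conjL2.symm : ComplexL2 →L[ℝ] ComplexL2) ∘L S t ∘L
      (conjL2 : ComplexL2 →L[ℝ] ComplexL2)) ComplexGraph := fun f g =>
    complexGraph_conj_iff.symm.trans (StronglyContinuousSemigroup.generates_conj hG conjL2 f g)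
  have hinv : ∀ t, 0 ≤ t → ∀ f : L2, toComplexL2 (reL2 (S t (toComplexL2 f)))
      = S t (toComplexL2 f) := by
    intro t ht f
    refine toComplexL2_reL2 ?_
    have h := congrArg (fun L : ComplexL2 →L[ℝ] ComplexL2 => L (toComplexL2 f))
      ((hS.conj conjL2).eq_of_generates hS hGc hG ht)
    have h' : conjL2 (S t (conjL2 (toComplexL2 f))) = S t (toComplexL2 f) := h
    rwa [conjL2_toComplexL2] at h'
  have hJ : ‖toComplexL2‖ ≤ 1 := Complex.ofRealCLM_norm ▸ ContinuousLinearMap.norm_compLpL_le _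
  have hP : ‖reL2‖ ≤ 1 := Complex.reCLM_norm ▸ ContinuousLinearMap.norm_compLpL_le _
  obtain ⟨T, hT, hTG⟩ := exists_perturbed_semigroup (hS.restrict reL2_toComplexL2 hinv)
    (fun t _ => ContinuousLinearMap.opNorm_le_bound _ zero_le_one fun f => by
      have h1 := reL2.le_of_opNorm_le hP (S t (toComplexL2 f))
      have h2 := (S t).le_of_opNorm_le (hS1 t) (toComplexL2 f)
      have h3 := toComplexL2.le_of_opNorm_le hJ f
      simp only [one_mul] at h1 h2 h3 ⊢
      exact h1.trans (h2.trans h3))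
    (StronglyContinuousSemigroup.generates_restrict reL2_toComplexL2 hinv hG) (mulL lam0)
  exact ⟨T, hT, fun f g => graphA_iff.trans (hTG f g)⟩

end KdVBurgers

/-! ### The method of steps for the delayed equation -/

section Delay

variable {X : Type*} [NormedAddCommGroup X] [NormedSpace ℝ X]
  {S : ℝ → X →L[ℝ] X}

/-- Two solutions of the delayed Duhamel equation with the same history coincide. -/
theorem eqOn_of_delay_duhamel {τ : ℝ} (hτ : 0 < τ) (B : X → X) {u v : ℝ → X} {x : X}
    (h0 : EqOn v u (Icc (-τ) 0))
    (hu : ∀ t, 0 ≤ t → u t = S t x - ∫ s in (0 : ℝ)..t, S (t - s) (B (u (s - τ))))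
    (hv : ∀ t, 0 ≤ t → v t = S t x - ∫ s in (0 : ℝ)..t, S (t - s) (B (v (s - τ)))) :
    EqOn v u (Ici (-τ)) := by
  -- For t ≤ (n + 1) τ the integrand uses values only at s - τ ≤ n τ, where the two solutions
  -- already agree.
  have key : ∀ n : ℕ, EqOn v u (Icc (-τ) (n * τ)) := by
    intro n
    induction n with
    | zero => simpa using h0
    | succ n ih =>
      intro t ht
      rcases le_total t 0 with h | h
      · exact h0 ⟨ht.1, h⟩
      rw [hu t h, hv t h]
      congr 1
      refine intervalIntegral.integral_congr fun s hs => ?_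
      rw [uIcc_of_le h] at hs
      have ht2 := ht.2
      push_cast at ht2
      rw [ih ⟨by linarith [hs.1], by linarith [hs.2]⟩]
  intro t ht
  obtain ⟨n, hn⟩ := exists_nat_ge (t / τ)
  exact key n ⟨ht, (div_le_iff₀ hτ).1 hn⟩

variable [CompleteSpace X]

/-- Existence for the delayed Duhamel equation by the method of steps. -/
theorem exists_delay_duhamel (hS : StronglyContinuousSemigroup S) {τ : ℝ} (hτ : 0 < τ)
    (B : X →L[ℝ] X) {u₀ : ℝ → X} (hu₀ : ContinuousOn u₀ (Icc (-τ) 0)) :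
    ∃ u : ℝ → X, Continuous u ∧ EqOn u u₀ (Icc (-τ) 0) ∧
      ∀ t, 0 ≤ t → u t = S t (u₀ 0) - ∫ s in (0 : ℝ)..t, S (t - s) (B (u (s - τ))) := by
  have hle : -τ ≤ 0 := by linarith
  set w : ℝ → X := fun t => u₀ (max (-τ) (min t 0)) with hw
  have hwc : Continuous w := hu₀.comp_continuous (by fun_prop) fun t =>
    ⟨le_max_left _ _, max_le hle (min_le_right _ _)⟩
  have hw0 : ∀ t, t ∈ Icc (-τ) 0 → w t = u₀ t := fun t ht => by
    simp only [hw]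
    rw [min_eq_left ht.2, max_eq_right ht.1]
  have hwmin : ∀ t, w (min t 0) = w t := fun t => by
    simp only [hw]
    rw [min_assoc, min_self]
  -- Here w is the history frozen outside [-τ, 0]. One formula covers both regimes: for t ≤ 0 it
  -- reduces to w t, and for t ≥ 0 the free term is S t (u₀ 0), as w t = u₀ 0. The n-th iterate is
  -- final on (-∞, n τ].
  let step : (ℝ → X) → ℝ → X := fun v t => S (max t 0) (w t)
    - ∫ s in (0 : ℝ)..max t 0, S (max (max t 0 - s) 0) (B (v (s - τ)))
  let U : ℕ → ℝ → X := fun n => step^[n] w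
  have hUs : ∀ n t, U (n + 1) t = S (max t 0) (w t)
      - ∫ s in (0 : ℝ)..max t 0, S (max (max t 0 - s) 0) (B (U n (s - τ))) := by
    intro n t
    change (step^[n + 1] w) t = step (step^[n] w) t
    rw [Function.iterate_succ_apply']
  have hUc : ∀ n, Continuous (U n) := by
    intro n
    induction n with
    | zero => exact hwc
    | succ n ih =>
      have h1 := (hS.continuous_duhamel (B.continuous.comp (ih.comp
        (by fun_prop : Continuous fun s => s - τ)))).comp
        (by fun_prop : Continuous fun t : ℝ => max t 0)
      have h2 := (hS.continuous_comp continuous_id hwc).sub h1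
      refine h2.congr fun t => ?_
      rw [hUs]
      rfl
  have hU1 : ∀ (n : ℕ) (t : ℝ), t ≤ n * τ → U (n + 1) t = U n t := by
    intro n
    induction n with
    | zero =>
      intro t ht
      have ht : t ≤ 0 := by simpa using ht
      rw [hUs, max_eq_right ht, intervalIntegral.integral_same, hS.map_zero_apply, sub_zero]
      rfl
    | succ n ih =>
      intro t ht
      push_cast at ht
      rw [hUs (n + 1), hUs n]
      congr 1
      refine intervalIntegral.integral_congr fun s hs => ?_
      rw [uIcc_of_le (le_max_right _ _)] at hs
      have h2 : max t 0 ≤ (n + 1) * τ := max_le ht (by positivity)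
      rw [ih _ (by linarith [hs.2])]
  have hUm : ∀ n m : ℕ, n ≤ m → ∀ t, t ≤ n * τ → U m t = U n t := by
    intro n m hnm
    induction m, hnm using Nat.le_induction with
    | base => exact fun _ _ => rfl
    | succ m hm ih =>
      intro t ht
      rw [hU1 m t (ht.trans (by gcongr)), ih t ht]
  -- At time t the first iterate that is already final there is used; any later one gives the same
  -- value.
  set u : ℝ → X := fun t => U ⌈t / τ⌉₊ t with hu
  have huU : ∀ (n : ℕ) (t : ℝ), t ≤ n * τ → u t = U n t := by
    intro n t ht
    have h1 : t ≤ ⌈t / τ⌉₊ * τ := (div_le_iff₀ hτ).1 (Nat.le_ceil _)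
    have h2 := hUm _ _ (le_max_left n ⌈t / τ⌉₊) t ht
    have h3 := hUm _ _ (le_max_right n ⌈t / τ⌉₊) t h1
    exact h3.symm.trans h2
  refine ⟨u, ?_, fun t ht => ?_, fun t ht => ?_⟩
  · rw [continuous_iff_continuousAt]
    intro t
    obtain ⟨n, hn⟩ := exists_nat_gt (t / τ)
    have hn : t < n * τ := (div_lt_iff₀ hτ).1 hn
    refine (hUc n).continuousAt.congr ?_
    filter_upwards [gt_mem_nhds hn] with s hs
    exact (huU n s hs.le).symm
  · rw [huU 0 t (by simpa using ht.2)]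
    exact hw0 t ht
  · obtain ⟨n, hn⟩ := exists_nat_ge (t / τ)
    have hn : t ≤ n * τ := (div_le_iff₀ hτ).1 hn
    rw [huU (n + 1) t (by push_cast; linarith), hUs, max_eq_left ht]
    have e : w t = u₀ 0 := by
      rw [← hwmin, min_eq_right ht, hw0 0 ⟨hle, le_rfl⟩]
    rw [e]
    congr 1
    refine intervalIntegral.integral_congr fun s hs => ?_
    rw [uIcc_of_le ht] at hs
    rw [max_eq_left (sub_nonneg.2 hs.2), huU n (s - τ) (by linarith [hs.2])]

end Delay

end DelayKdVB

/-! ### Well-posedness of the delayed problem -/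

open DelayKdVB in
theorem theorem2p2 (τ : ℝ) (hτ : 0 < τ) (lam0 lam : DelayKdVB.LInf) (u₀ : ℝ → DelayKdVB.L2)
    (hu₀ : ContinuousOn u₀ (Set.Icc (-τ) 0)) :
    ∃ u : ℝ → DelayKdVB.L2, DelayKdVB.IsSolution τ lam0 lam u₀ u ∧
      ∀ v : ℝ → DelayKdVB.L2, DelayKdVB.IsSolution τ lam0 lam u₀ v →
        Set.EqOn v u (Set.Ici (-τ)) := by
  obtain ⟨S, hS, hG⟩ := exists_semigroup lam0
  obtain ⟨u, huc, hu0, hu⟩ := exists_delay_duhamel hS hτ (mulL lam) hu₀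
  refine ⟨u, ⟨huc.continuousOn, hu0, S, ⟨hS.map_zero, hS.map_add, hS.continuousOn⟩, hG, hu⟩, ?_⟩
  intro v hv
  obtain ⟨T, hT, hTG, hvT⟩ := hv.duhamel
  have hT' : StronglyContinuousSemigroup T := ⟨hT.map_zero, hT.map_add, hT.continuousOn⟩
  -- The competitor v comes with its own semigroup T, which agrees with S only for nonnegative
  -- times; the integrand needs it only at t - s ≥ 0.
  have hTS : ∀ t, 0 ≤ t → T t = S t := fun t ht => hT'.eq_of_generates hS hTG hG ht
  refine eqOn_of_delay_duhamel hτ (mulL lam)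
    (fun s hs => (hv.history s hs).trans (hu0 hs).symm) hu fun t ht => ?_
  rw [hvT t ht, hTS t ht]
  congr 1
  refine intervalIntegral.integral_congr fun s hs => ?_
  rw [Set.uIcc_of_le ht] at hs
  rw [hTS _ (sub_nonneg.2 hs.2), mulL_apply]
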